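/- Let $L>0$, $R>0$, let $D=\{(\tilde x,x_3):\tilde x\in\mathbb R^2,\ 0<x_3<L\}$ and $\alpha_n=\frac{(2n-1)\pi}{2L}$ for $n\ge 1$. For $f\in L^2(D)$ (complex-valued) supported in $\{|\tilde x|\le R\}$ define its modes $$f_n(\tilde x)=\frac2L\int_0^L f(\tilde x,x_3)\sin(\alpha_nx_3)\,\mathrm dx_3,\qquad n\ge1,$$ their Fourier transforms $\hat f_n(\xi)=\int_{\mathbb R^2}e^{-\mathrm i\tilde y\cdot\xi}f_n(\tilde y)\,\mathrm d\tilde y$, and, for $k>0$, $\hat x\in\mathbb S=\{\tilde x\in\mathbb R^2:|\tilde x|=1\}$ and $x_3\in\mathbb R$, the far-field pattern (of the waveguide problem with potential $V=0$) $$A_\infty(k,\hat x,x_3)=A_\infty^f(k,\hat x,x_3)=\sum_{n\ge1,\ \alpha_n<k}\hat f_n\big(\beta_n(k)\hat x\big)\sin(\alpha_nx_3),\qquad \beta_n(k)=\sqrt{k^2-\alpha_n^2}.$$ Fix a positive integer $N_0$ and let $\mathcal C$ be the set of all such $f$ having only the first $N_0$ modes, i.e. $f(x)=\sum_{n=1}^{N_0}f_n(\tilde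 x)\sin(\alpha_nx_3)$ for almost every $x\in D$. Let $x_3\in\mathbb R$ satisfy $\sin(\alpha_nx_3)\ne0$ for $1\le n\le N_0$, and for $1\le i\le N_0$ let $I_i\subset(\alpha_i,\alpha_{i+1})$ be an interval with more than one point. **Theorem.** The far-field data $\{A_\infty(k,\hat x,x_3):\hat x\in\mathbb S,\ k\in\bigcup_{i=1}^{N_0}I_i\}$ uniquely determine $f$ in $\mathcal C$: if $f,g\in\mathcal C$ and $A_\infty^f(k,\hat x,x_3)=A_\infty^g(k,\hat x,x_3)$ for all $\hat x\in\mathbb S$ and $k\in\bigcup_{i=1}^{N_0}I_i$, then $f=g$ almost everywhere in $D$. Moreover the modes are determined recursively: if $f,g\in\mathcal C$, $1\le m\le N_0$, $f_n=g_n$ almost everywhere for all $1\le n<m$, and $A_\infty^f(k,\hat x,x_3)=A_\infty^g(k,\hat x,x_3)$ for all $\hat x\in\mathbb S$ and $k\in I_m$, then $f_m=g_m$ almost everywhere. -/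

import Mathlib

open MeasureTheory

noncomputable section

namespace Waveguide

/-- The horizontal plane of the variables `x̃ = (x₁, x₂)`. -/
abbrev Plane : Type := EuclideanSpace ℝ (Fin 2)

/-- The slab `D = {(x̃, x₃) : x̃ ∈ ℝ², 0 < x₃ < L}`; a point of space is a pair `(x̃, x₃)`. -/
def slab (L : ℝ) : Set (Plane × ℝ) := {x | 0 < x.2 ∧ x.2 < L}

/-- The vertical wavenumbers `α_n = (2 n - 1) π / (2 L)`, used for `n ≥ 1`. -/
def alpha (L : ℝ) (n : ℕ) : ℝ := (2 * (n : ℝ) - 1) * Real.pi / (2 * L)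

/-- The modal wavenumber `β_n(k) = √(k² - α_n²)` of a propagating mode, `k > α_n`. -/
def beta (L : ℝ) (n : ℕ) (k : ℝ) : ℝ := Real.sqrt (k ^ 2 - alpha L n ^ 2)

/-- The modes `f_n(x̃) = (2 / L) ∫₀ᴸ f(x̃, x₃) sin(α_n x₃) dx₃`. -/
def mode (L : ℝ) (f : Plane × ℝ → ℂ) (n : ℕ) (y : Plane) : ℂ :=
  (2 / L : ℝ) * ∫ t in (0 : ℝ)..L, f (y, t) * (Real.sin (alpha L n * t) : ℂ)

/-- The Fourier transform `ĝ(ξ) = ∫ exp(-i y·ξ) g(y) dy` on the plane. -/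
def planeFourier (g : Plane → ℂ) (ξ : Plane) : ℂ :=
  ∫ y : Plane, Complex.exp (-Complex.I * (inner ℝ y ξ : ℝ)) * g y

/-- The indices `n ≥ 1` of the modes that propagate at wavenumber `k`. -/
def propagating (L k : ℝ) : Set ℕ := {n | 1 ≤ n ∧ alpha L n < k}

/-- Only finitely many modes propagate, so that the finite sum in `farField` is a genuine one. -/
theorem propagating_finite {L : ℝ} (hL : 0 < L) (k : ℝ) : (propagating L k).Finite := by
  refine (Set.finite_Iio (⌈k * L / Real.pi + 1 / 2⌉₊)).subset ?_
  rintro n ⟨-, hn⟩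
  rw [Set.mem_Iio, Nat.lt_ceil]
  have hpi := Real.pi_pos
  rw [alpha, div_lt_iff₀ (by positivity)] at hn
  have h : ((n : ℝ) - 1 / 2) < k * L / Real.pi := by
    rw [lt_div_iff₀ hpi]
    linarith
  linarith

/-- The far-field pattern
`A_∞(k, θ, x₃) = ∑_{n ≥ 1, k > α_n} f̂_n(β_n(k) θ) sin(α_n x₃)`. -/
def farField (L : ℝ) (f : Plane × ℝ → ℂ) (k : ℝ) (θ : Plane) (x₃ : ℝ) : ℂ :=
  ∑ᶠ n ∈ propagating L k,
    planeFourier (mode L f n) (beta L n k • θ) * (Real.sin (alpha L n * x₃) : ℂ)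

/-- `f ∈ L²(D)`, supported in the cylinder `{|x̃| ≤ R}`, with at most the first `N₀` modes. -/
structure IsSource (L R : ℝ) (N₀ : ℕ) (f : Plane × ℝ → ℂ) : Prop where
  memLp : MemLp f 2 (volume.restrict (slab L))
  supported : ∀ᵐ x ∂(volume.restrict (slab L)), R < ‖x.1‖ → f x = 0
  finite_modes : ∀ᵐ x ∂(volume.restrict (slab L)),
    f x = ∑ n ∈ Finset.Icc 1 N₀, mode L f n x.1 * (Real.sin (alpha L n * x.2) : ℂ)

end Waveguide

end

/-! For `k` between the cut-offs `α_m` and `α_{m+1}` exactly the modes `1, …, m` propagate. If the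
modes below `m` agree, subtracting the two far fields leaves one term, and dividing by `sin (α_m x₃)
≠ 0` shows that the Fourier transform of the difference of the `m`-th modes vanishes at `β_m(k) θ`
for every direction `θ`. As `k` runs through an interval these points fill an annulus. The
difference has compact support, so on each ray its transform extends to an entire function; the
identity theorem makes it zero on every ray, and Fourier injectivity finishes
(`ae_eq_zero_of_planeFourier_annulus`). Induction on `m` yields all modes, and these determine a
source. -/

open Real FourierTransform SchwartzMap in
/-- The Fourier transform is injective on integrable functions. -/
theorem ae_eq_zero_of_fourier_eq_zero {E : Type*} [NormedAddCommGroup E] [InnerProductSpace ℝ E]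
    [FiniteDimensional ℝ E] [MeasurableSpace E] [BorelSpace E] {g : E → ℂ} (hg : Integrable g)
    (h : ∀ ξ, 𝓕 g ξ = 0) : g =ᵐ[volume] 0 := by
  refine ae_eq_zero_of_integral_contDiff_smul_eq_zero hg.locallyIntegrable fun φ hφ hc => ?_
  have hφ' : ContDiff ℝ ((⊤ : ℕ∞) : WithTop ℕ∞) (fun x => (φ x : ℂ)) :=
    Complex.ofRealCLM.contDiff.comp hφ
  have hc' : HasCompactSupport (fun x => (φ x : ℂ)) :=
    hc.comp_left (g := fun x : ℝ => (x : ℂ)) Complex.ofReal_zero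
  let ψ : 𝓢(E, ℂ) := hc'.toSchwartzMap hφ'
  -- Write the test function as the transform of `𝓕⁻ ψ` and move the transform onto `g`, where it
  -- vanishes.
  have key : ∫ ξ, 𝓕 g ξ * (𝓕⁻ ψ : 𝓢(E, ℂ)) ξ = ∫ x, g x * 𝓕 (𝓕⁻ ψ : 𝓢(E, ℂ)) x := by
    simpa only [ContinuousLinearMap.mul_apply', flip_innerₗ] using!
      VectorFourier.integral_bilin_fourierIntegral_eq_flip (.mul ℂ ℂ) (L := innerₗ E)
      continuous_fourierChar continuous_inner hg
      (SchwartzMap.integrable (μ := volume) (𝓕⁻ ψ : 𝓢(E, ℂ)))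
  have hψ : 𝓕 (𝓕⁻ ψ : 𝓢(E, ℂ)) = ψ := FourierTransform.fourier_fourierInv_eq ψ
  simp only [hψ, h, zero_mul, integral_zero] at key
  rw [key]
  refine integral_congr_ae (ae_of_all _ fun x => ?_)
  simp [ψ, mul_comm]

/-! ### Fourier transforms of compactly supported functions on the plane -/

namespace Waveguide

theorem planeFourier_eq_fourier (g : Plane → ℂ) (ξ : Plane) :
    planeFourier g ((2 * Real.pi) • ξ) = FourierTransform.fourier g ξ := by
  rw [Real.fourier_eq', planeFourier]
  refine integral_congr_ae (ae_of_all _ fun y => ?_)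
  simp only [smul_eq_mul, inner_smul_right]
  congr 2
  push_cast
  ring

theorem planeFourier_congr {g h : Plane → ℂ} (hgh : g =ᵐ[volume] h) (ξ : Plane) :
    planeFourier g ξ = planeFourier h ξ :=
  integral_congr_ae (hgh.mono fun y hy => by simp only [hy])

theorem integrable_exp_mul {g : Plane → ℂ} (hg : Integrable g) (ξ : Plane) :
    Integrable fun y : Plane => Complex.exp (-Complex.I * (inner ℝ y ξ : ℝ)) * g y := by
  refine hg.bdd_mul (c := 1) (by fun_prop) (ae_of_all _ fun y => ?_)
  rw [Complex.norm_exp]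
  simp

theorem planeFourier_sub {g h : Plane → ℂ} (hg : Integrable g) (hh : Integrable h) (ξ : Plane) :
    planeFourier (g - h) ξ = planeFourier g ξ - planeFourier h ξ := by
  rw [planeFourier, planeFourier, planeFourier,
    ← integral_sub (integrable_exp_mul hg ξ) (integrable_exp_mul hh ξ)]
  simp only [Pi.sub_apply, mul_sub]

/-- The Fourier transform of a compactly supported function extends along each line to an entire
function. -/
theorem differentiable_integral_exp_inner {g : Plane → ℂ} {R : ℝ} (hg : Integrable g)
    (hR : ∀ᵐ y, R < ‖y‖ → g y = 0) {θ : Plane} (hθ : ‖θ‖ = 1) :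
    Differentiable ℂ fun z : ℂ =>
      ∫ y : Plane, Complex.exp (-Complex.I * (z * (inner ℝ y θ : ℝ))) * g y := by
  intro z₀
  have hmeas : ∀ z : ℂ, AEStronglyMeasurable
      (fun y : Plane => Complex.exp (-Complex.I * (z * (inner ℝ y θ : ℝ))) * g y) volume :=
    fun z => AEStronglyMeasurable.mul (by fun_prop) hg.aestronglyMeasurable
  -- Where `g` is nonzero, `|y·θ| ≤ |R|`, which bounds the kernel and its `z`-derivative uniformly
  -- near `z₀`. The absolute value avoids assuming a sign for `R`.
  have hbound : ∀ᵐ y : Plane, ∀ z ∈ Metric.ball z₀ 1,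
      ‖Complex.exp (-Complex.I * (z * (inner ℝ y θ : ℝ))) * g y‖ ≤
        Real.exp ((‖z₀‖ + 1) * |R|) * ‖g y‖ ∧ |inner ℝ y θ| * ‖g y‖ ≤ |R| * ‖g y‖ := by
    filter_upwards [hR] with y hy z hz
    by_cases hyR : R < ‖y‖
    · simp [hy hyR]
    have hi : |inner ℝ y θ| ≤ |R| := by
      have h := abs_real_inner_le_norm y θ
      rw [hθ, mul_one] at h
      exact h.trans ((not_lt.1 hyR).trans (le_abs_self R))
    refine ⟨?_, by gcongr⟩
    rw [norm_mul]
    gcongr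
    refine (Complex.norm_exp_le_exp_norm _).trans (Real.exp_le_exp.2 ?_)
    have hz' : ‖z‖ ≤ ‖z₀‖ + 1 := by
      have h := norm_sub_norm_le z z₀
      have h' := mem_ball_iff_norm.1 hz
      linarith
    simp only [norm_mul, norm_neg, Complex.norm_I, one_mul, Complex.norm_real, Real.norm_eq_abs]
    gcongr
  refine (hasDerivAt_integral_of_dominated_loc_of_deriv_le
    (F' := fun z y => (-Complex.I * (inner ℝ y θ : ℝ)) *
      (Complex.exp (-Complex.I * (z * (inner ℝ y θ : ℝ))) * g y))
    (bound := fun y => |R| * (Real.exp ((‖z₀‖ + 1) * |R|) * ‖g y‖))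
    (Metric.ball_mem_nhds z₀ one_pos) (Filter.Eventually.of_forall hmeas) ?_ ?_ ?_ ?_
    ?_).2.differentiableAt
  · refine (hg.norm.const_mul (Real.exp ((‖z₀‖ + 1) * |R|))).mono' (hmeas z₀) ?_
    filter_upwards [hbound] with y hy using (hy z₀ (Metric.mem_ball_self one_pos)).1
  · exact AEStronglyMeasurable.mul (by fun_prop) (hmeas z₀)
  · filter_upwards [hbound, hR] with y hy hyR z hz
    have h := hy z hz
    by_cases hyR' : g y = 0
    · simp [hyR']
    have hpos : 0 < ‖g y‖ := norm_pos_iff.2 hyR'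
    rw [norm_mul]
    refine mul_le_mul ?_ h.1 (norm_nonneg _) (abs_nonneg _)
    simpa using le_of_mul_le_mul_right h.2 hpos
  · exact (hg.norm.const_mul _).const_mul _
  · refine ae_of_all _ fun y z _ => ?_
    have h : HasDerivAt (fun z : ℂ => -Complex.I * (z * ((inner ℝ y θ : ℝ) : ℂ)))
        (-Complex.I * ((inner ℝ y θ : ℝ) : ℂ)) z := by
      simpa using ((hasDerivAt_id z).mul_const ((inner ℝ y θ : ℝ) : ℂ)).const_mul (-Complex.I)
    exact (h.cexp.mul_const (g y)).congr_deriv (by ring)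

/-- A compactly supported function whose Fourier transform vanishes on an annulus is zero. -/
theorem ae_eq_zero_of_planeFourier_annulus {g : Plane → ℂ} {R a b : ℝ} (hg : Integrable g)
    (hR : ∀ᵐ y, R < ‖y‖ → g y = 0) (hab : a < b)
    (h : ∀ r ∈ Set.Icc a b, ∀ θ ∈ Metric.sphere (0 : Plane) 1, planeFourier g (r • θ) = 0) :
    g =ᵐ[volume] 0 := by
  have hray : ∀ θ ∈ Metric.sphere (0 : Plane) 1, ∀ r : ℝ, planeFourier g (r • θ) = 0 := by
    intro θ hθ
    have hd := differentiable_integral_exp_inner hg hR (mem_sphere_zero_iff_norm.1 hθ)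
    set F : ℂ → ℂ := fun z => ∫ y : Plane, Complex.exp (-Complex.I * (z * (inner ℝ y θ : ℝ))) * g y
      with hF
    have hFr : ∀ r : ℝ, F r = planeFourier g (r • θ) := fun r => by
      simp only [hF, planeFourier, inner_smul_right, Complex.ofReal_mul]
    -- The real zeros in `(a, b)` accumulate at `a`.
    have hz : ∃ᶠ z in nhdsWithin (a : ℂ) {(a : ℂ)}ᶜ, F z = 0 := by
      have ht : Filter.Tendsto (fun r : ℝ => (r : ℂ)) (nhdsWithin a (Set.Ioi a))
          (nhdsWithin (a : ℂ) {(a : ℂ)}ᶜ) := by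
        refine tendsto_nhdsWithin_iff.2 ⟨(Complex.continuous_ofReal.tendsto a).mono_left
          nhdsWithin_le_nhds, ?_⟩
        filter_upwards [self_mem_nhdsWithin] with r hr
        simpa using (ne_of_gt hr)
      refine ht.frequently (Filter.Eventually.frequently ?_)
      filter_upwards [Ioo_mem_nhdsGT hab] with r hr
      rw [hFr]
      exact h r (Set.Ioo_subset_Icc_self hr) θ hθ
    have hF0 := AnalyticOnNhd.eqOn_zero_of_preconnected_of_frequently_eq_zero
      (fun z _ => hd.analyticAt z) isPreconnected_univ (Set.mem_univ (a : ℂ)) hz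
    intro r
    rw [← hFr]
    exact hF0 (Set.mem_univ _)
  refine ae_eq_zero_of_fourier_eq_zero hg fun ξ => ?_
  rw [← planeFourier_eq_fourier]
  set η : Plane := (2 * Real.pi) • ξ
  rcases eq_or_ne η 0 with hη | hη
  -- The origin has no direction of its own but lies on every ray.
  · have h0 := hray (EuclideanSpace.single 0 1) (by simp) 0
    rwa [zero_smul, ← hη] at h0
  · have h1 := hray (‖η‖⁻¹ • η) (by simp [norm_smul, hη]) ‖η‖
    rwa [smul_inv_smul₀ (norm_ne_zero_iff.2 hη)] at h1

/-! ### Cut-offs and propagating modes -/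

theorem alpha_strictMono {L : ℝ} (hL : 0 < L) : StrictMono (alpha L) := by
  intro m n hmn
  have h : (m : ℝ) < n := Nat.cast_lt.2 hmn
  have := Real.pi_pos
  unfold alpha
  gcongr

theorem alpha_nonneg {L : ℝ} (hL : 0 < L) {n : ℕ} (hn : 1 ≤ n) : 0 ≤ alpha L n := by
  have h : (1 : ℝ) ≤ n := Nat.one_le_cast.2 hn
  have := Real.pi_pos
  unfold alpha
  have : 0 ≤ 2 * (n : ℝ) - 1 := by linarith
  positivity

theorem propagating_eq_Icc {L k : ℝ} (hL : 0 < L) {m : ℕ}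
    (hk : k ∈ Set.Ioo (alpha L m) (alpha L (m + 1))) : propagating L k = ↑(Finset.Icc 1 m) := by
  ext n
  simp only [propagating, Set.mem_ofPred_eq, Finset.coe_Icc, Set.mem_Icc]
  refine and_congr_right fun _ => ⟨fun h => ?_, fun h => ?_⟩
  · exact Nat.lt_succ_iff.1 ((alpha_strictMono hL).lt_iff_lt.1 (h.trans hk.2))
  · exact ((alpha_strictMono hL).monotone h).trans_lt hk.1

theorem farField_eq_sum {L k : ℝ} (hL : 0 < L) {m : ℕ}
    (hk : k ∈ Set.Ioo (alpha L m) (alpha L (m + 1))) (f : Plane × ℝ → ℂ) (θ : Plane) (x₃ : ℝ) :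
    farField L f k θ x₃ = ∑ n ∈ Finset.Icc 1 m,
      planeFourier (mode L f n) (beta L n k • θ) * (Real.sin (alpha L n * x₃) : ℂ) := by
  rw [farField, propagating_eq_Icc hL hk]
  exact finsum_mem_coe_finset _ _

/-! ### The slab as a product, and regularity of the modes -/

theorem volume_restrict_slab (L : ℝ) :
    (volume : Measure (Plane × ℝ)).restrict (slab L) =
      (volume : Measure Plane).prod (volume.restrict (Set.Ioo 0 L)) := by
  have h : slab L = Set.univ ×ˢ Set.Ioo 0 L := by
    ext x
    simp [slab]
  rw [h, Measure.volume_eq_prod, ← Measure.prod_restrict, Measure.restrict_univ]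

namespace IsSource

variable {L R : ℝ} {N₀ : ℕ} {f : Plane × ℝ → ℂ}

/-- The part of the slab with `‖x.1‖ ≤ R` has finite measure, so there `L²` is contained in `L¹`. -/
theorem integrable (hf : IsSource L R N₀ f) : Integrable f (volume.restrict (slab L)) := by
  have hs : MeasurableSet {x : Plane × ℝ | ‖x.1‖ ≤ R} :=
    measurableSet_le (by fun_prop) (by fun_prop)
  have hae : {x : Plane × ℝ | ‖x.1‖ ≤ R}.indicator f =ᵐ[volume.restrict (slab L)] f := by
    filter_upwards [hf.supported] with x hx
    by_cases h : ‖x.1‖ ≤ R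
    · simp [h]
    · simp [h, hx (not_le.1 h)]
  refine Integrable.congr ((integrable_indicator_iff hs).2 ?_) hae
  have : IsFiniteMeasure ((volume.restrict (slab L)).restrict {x : Plane × ℝ | ‖x.1‖ ≤ R}) := by
    refine ⟨?_⟩
    have h : {x : Plane × ℝ | ‖x.1‖ ≤ R} = Metric.closedBall (0 : Plane) R ×ˢ Set.univ := by
      ext x
      simp
    rw [Measure.restrict_apply_univ, volume_restrict_slab, h, Measure.prod_prod,
      Measure.restrict_apply_univ]
    exact ENNReal.mul_lt_top measure_closedBall_lt_top measure_Ioo_lt_top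
  exact (hf.memLp.restrict _).integrable one_le_two

theorem mode_eq (hL : 0 < L) (f : Plane × ℝ → ℂ) (n : ℕ) (y : Plane) :
    mode L f n y = (2 / L : ℝ) *
      ∫ t in Set.Ioo 0 L, f (y, t) * (Real.sin (alpha L n * t) : ℂ) := by
  rw [mode, intervalIntegral.integral_of_le hL.le, integral_Ioc_eq_integral_Ioo]

theorem integrable_mode (hL : 0 < L) (hf : IsSource L R N₀ f) (n : ℕ) :
    Integrable (mode L f n) := by
  have h : Integrable (fun x : Plane × ℝ => f x * (Real.sin (alpha L n * x.2) : ℂ))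
      ((volume : Measure Plane).prod (volume.restrict (Set.Ioo 0 L))) := by
    rw [← volume_restrict_slab]
    refine hf.integrable.mul_bdd (c := 1) (by fun_prop) (ae_of_all _ fun x => ?_)
    rw [Complex.norm_real]
    exact Real.abs_sin_le_one _
  rw [funext (mode_eq hL f n)]
  exact h.integral_prod_left.const_mul _

theorem mode_eq_zero (hL : 0 < L) (hf : IsSource L R N₀ f) (n : ℕ) :
    ∀ᵐ y, R < ‖y‖ → mode L f n y = 0 := by
  have h := hf.supported
  rw [volume_restrict_slab] at h
  filter_upwards [Measure.ae_ae_of_ae_prod h] with y hy hyR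
  rw [mode_eq hL, integral_eq_zero_of_ae, mul_zero]
  filter_upwards [hy] with t ht
  simp [ht hyR]

/-- Two sources with the same modes agree almost everywhere. -/
theorem ae_eq_of_mode_ae_eq {g : Plane × ℝ → ℂ} (hf : IsSource L R N₀ f) (hg : IsSource L R N₀ g)
    (h : ∀ n ∈ Finset.Icc 1 N₀, mode L f n =ᵐ[volume] mode L g n) :
    f =ᵐ[volume.restrict (slab L)] g := by
  have hall : ∀ᵐ y : Plane, ∀ n ∈ Finset.Icc 1 N₀, mode L f n y = mode L g n y :=
    (ae_ball_iff (Finset.Icc 1 N₀).countable_toSet).2 h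
  have hlift : ∀ᵐ x ∂(volume.restrict (slab L)),
      ∀ n ∈ Finset.Icc 1 N₀, mode L f n x.1 = mode L g n x.1 := by
    rw [volume_restrict_slab]
    exact Measure.quasiMeasurePreserving_fst.ae hall
  filter_upwards [hf.finite_modes, hg.finite_modes, hlift] with x hfx hgx hx
  rw [hfx, hgx]
  exact Finset.sum_congr rfl fun n hn => by rw [hx n hn]

end IsSource

/-! ### Recovery of the modes one at a time -/

theorem exists_Icc_subset_beta_image {L : ℝ} (hL : 0 < L) {m : ℕ} (hm : 1 ≤ m) {s : Set ℝ}
    (hs : s.OrdConnected) (hs' : s.Nontrivial) (hsub : s ⊆ Set.Ioi (alpha L m)) :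
    ∃ a b, a < b ∧ Set.Icc a b ⊆ beta L m '' s := by
  obtain ⟨p, hp, q, hq, hpq⟩ := hs'.exists_lt
  have hα := alpha_nonneg hL hm
  have hαp : alpha L m < p := hsub hp
  refine ⟨beta L m p, beta L m q, ?_, ?_⟩
  · exact Real.sqrt_lt_sqrt (by nlinarith) (by nlinarith)
  -- `β_m` is continuous, so it takes every value between those at `p` and `q`.
  · refine (intermediate_value_Icc hpq.le ?_).trans (Set.image_mono (hs.out hp hq))
    unfold beta
    fun_prop

/-- The far field on an interval between the cut-offs `α_m` and `α_{m+1}` determines the `m`-th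
mode, once the lower modes are known. -/
theorem mode_ae_eq_of_farField_eq {L R x₃ : ℝ} (hL : 0 < L) {N₀ m : ℕ} (hm : 1 ≤ m)
    (hx₃ : Real.sin (alpha L m * x₃) ≠ 0) {s : Set ℝ} (hs : s.OrdConnected) (hs' : s.Nontrivial)
    (hsub : s ⊆ Set.Ioo (alpha L m) (alpha L (m + 1))) {f g : Plane × ℝ → ℂ}
    (hf : IsSource L R N₀ f) (hg : IsSource L R N₀ g)
    (hlow : ∀ n ∈ Finset.Ico 1 m, mode L f n =ᵐ[volume] mode L g n)
    (hfar : ∀ k ∈ s, ∀ θ ∈ Metric.sphere (0 : Plane) 1,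
      farField L f k θ x₃ = farField L g k θ x₃) :
    mode L f m =ᵐ[volume] mode L g m := by
  have hfm := hf.integrable_mode hL m
  have hgm := hg.integrable_mode hL m
  obtain ⟨a, b, hab, hsubset⟩ :=
    exists_Icc_subset_beta_image hL hm hs hs' fun k hk => (hsub hk).1
  have hR : ∀ᵐ y, R < ‖y‖ → (mode L f m - mode L g m) y = 0 := by
    filter_upwards [hf.mode_eq_zero hL m, hg.mode_eq_zero hL m] with y hfy hgy hy
    rw [Pi.sub_apply, hfy hy, hgy hy, sub_zero]
  refine (ae_eq_zero_of_planeFourier_annulus (hfm.sub hgm) hR hab ?_).mono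
    fun y hy => sub_eq_zero.1 hy
  intro r hr θ hθ
  obtain ⟨k, hk, rfl⟩ := hsubset hr
  have h := hfar k hk θ hθ
  -- Split off the term `n = m`; the remaining sums coincide by `hlow` and cancel.
  rw [farField_eq_sum hL (hsub hk), farField_eq_sum hL (hsub hk),
    ← Finset.Ico_insert_right hm, Finset.sum_insert Finset.right_notMem_Ico,
    Finset.sum_insert Finset.right_notMem_Ico,
    Finset.sum_congr rfl fun n hn => by rw [planeFourier_congr (hlow n hn)]] at h
  rw [planeFourier_sub hfm hgm, sub_eq_zero]
  exact mul_right_cancel₀ (Complex.ofReal_ne_zero.2 hx₃) (add_right_cancel h)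

end Waveguide

theorem theorem3p3 (L R : ℝ) (hL : 0 < L) (N₀ : ℕ) (x₃ : ℝ)
    (hx₃ : ∀ n ∈ Finset.Icc 1 N₀, Real.sin (Waveguide.alpha L n * x₃) ≠ 0)
    (I : ℕ → Set ℝ)
    (hI : ∀ i ∈ Finset.Icc 1 N₀, (I i).OrdConnected ∧ (I i).Nontrivial ∧
      I i ⊆ Set.Ioo (Waveguide.alpha L i) (Waveguide.alpha L (i + 1)))
    (f g : Waveguide.Plane × ℝ → ℂ)
    (hf : Waveguide.IsSource L R N₀ f) (hg : Waveguide.IsSource L R N₀ g) :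
    ((∀ k ∈ ⋃ i ∈ Finset.Icc 1 N₀, I i, ∀ θ ∈ Metric.sphere (0 : Waveguide.Plane) 1,
        Waveguide.farField L f k θ x₃ = Waveguide.farField L g k θ x₃) →
      f =ᵐ[volume.restrict (Waveguide.slab L)] g) ∧
    (∀ m ∈ Finset.Icc 1 N₀,
      (∀ n ∈ Finset.Ico 1 m, Waveguide.mode L f n =ᵐ[volume] Waveguide.mode L g n) →
      (∀ k ∈ I m, ∀ θ ∈ Metric.sphere (0 : Waveguide.Plane) 1,
        Waveguide.farField L f k θ x₃ = Waveguide.farField L g k θ x₃) →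
      Waveguide.mode L f m =ᵐ[volume] Waveguide.mode L g m) := by
  have hrec : ∀ m ∈ Finset.Icc 1 N₀,
      (∀ n ∈ Finset.Ico 1 m, Waveguide.mode L f n =ᵐ[volume] Waveguide.mode L g n) →
      (∀ k ∈ I m, ∀ θ ∈ Metric.sphere (0 : Waveguide.Plane) 1,
        Waveguide.farField L f k θ x₃ = Waveguide.farField L g k θ x₃) →
      Waveguide.mode L f m =ᵐ[volume] Waveguide.mode L g m := fun m hm =>
    Waveguide.mode_ae_eq_of_farField_eq hL (Finset.mem_Icc.1 hm).1 (hx₃ m hm) (hI m hm).1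
      (hI m hm).2.1 (hI m hm).2.2 hf hg
  refine ⟨fun h => hf.ae_eq_of_mode_ae_eq hg fun n => ?_, hrec⟩
  induction n using Nat.strong_induction_on with
  | _ n ih =>
    intro hn
    refine hrec n hn (fun j hj => ?_) fun k hk => h k (Set.mem_biUnion hn hk)
    have hj' := Finset.mem_Ico.1 hj
    exact ih j hj'.2 (Finset.mem_Icc.2 ⟨hj'.1, hj'.2.le.trans (Finset.mem_Icc.1 hn).2⟩)
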